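/- Let $K$ be an infinite field, $P=K[x_1,\dots,x_n]$, and identify a power product $t=x_1^{\alpha_1}\cdots x_n^{\alpha_n}$ with its fine ($\mathbb{Z}^n$-)degree $(\alpha_1,\dots,\alpha_n)$; its standard degree is $\deg t=\sum_i\alpha_i$. A *distraction matrix* is an infinite matrix $\mathcal{L}=(L_{ij}\mid 1\le i\le n,\ j\ge 1)$ of linear forms $L_{ij}\in P_1$ such that $L_{1j_1},\dots,L_{nj_n}$ span $P_1$ for all $j_1,\dots,j_n$, and such that for some $N$ one has $L_{ij}=L_{iN}$ for all $i$ and all $j>N$. For a power product $t$ put $D_{\mathcal{L}}(t)=\prod_{i=1}^n\prod_{j=1}^{\alpha_i}L_{ij}$. For polynomials $f,g$ with $g\neq0$ let $f::g$ be $h$ if $f=gh$, and $0$ if $g\nmid f$. For power products $t_1,\dots,t_r$ with $d_i=\deg t_i$, let $\bigoplus_{i=1}^r P(-t_i)$ be the fine graded free module whose basis vector $e_i$ has fine degree $t_i$, and let $$D_{\mathcal{L}}:\bigoplus_{i=1}^r P(-t_i)\to\bigoplus_{i=1}^r P(-d_i)$$ be the $K$-linear map with $D_{\mathcal{L}}(t\,e_i)=\bigl(D_{\mathcal{L}}(t\,t_i)/D_{\mathcal{L}}(t_i)\bigr)e_i$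 for every power product $t$. A $P$-linear map $\phi:\bigoplus_{i=1}^{r}P(-t_i)\to\bigoplus_{i=1}^{r'}P(-t_i')$ that preserves fine degrees has a matrix $(c_{ij}\,(t_j::t_i'))$ with $c_{ij}\in K$ (where $c_{ij}=0$ if $t_i'\nmid t_j$); let $D_{\mathcal{L}}(\phi):\bigoplus_{i=1}^{r}P(-d_i)\to\bigoplus_{i=1}^{r'}P(-d_i')$ be the $P$-linear map with matrix $(c_{ij}\,(D_{\mathcal{L}}(t_j)::D_{\mathcal{L}}(t_i')))$. **Theorem.** Let $\mathcal{L}$ be a distraction matrix. 1. Every map $D_{\mathcal{L}}:\bigoplus_{i=1}^r P(-t_i)\to\bigoplus_{i=1}^r P(-d_i)$ is an isomorphism of $K$-vector spaces that carries the vectors of each standard degree $e$ onto the vectors of standard degree $e$. 2. Let $\bigoplus_{i=1}^{r''}P(-t_i'')\xrightarrow{\ \psi\ }\bigoplus_{i=1}^{r}P(-t_i)\xrightarrow{\ \phi\ }\bigoplus_{i=1}^{r'}P(-t_i')$ be a complex ($\phi\psi=0$) of fine graded free modules and homomorphisms. Then: - $D_{\mathcal{L}}(\psi)$ and $D_{\mathcal{L}}(\phi)$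 preserve standard degrees and $D_{\mathcal{L}}(\phi)D_{\mathcal{L}}(\psi)=0$; - (a) $D_{\mathcal{L}}\circ\psi=D_{\mathcal{L}}(\psi)\circ D_{\mathcal{L}}$ and $D_{\mathcal{L}}\circ\phi=D_{\mathcal{L}}(\phi)\circ D_{\mathcal{L}}$; - (b) $D_{\mathcal{L}}(\operatorname{Ker}\phi)=\operatorname{Ker}D_{\mathcal{L}}(\phi)$ and $D_{\mathcal{L}}(\operatorname{Im}\phi)=\operatorname{Im}D_{\mathcal{L}}(\phi)$; - (c), (d) $D_{\mathcal{L}}$ induces a $K$-linear isomorphism $\operatorname{Ker}\phi/\operatorname{Im}\psi\to\operatorname{Ker}D_{\mathcal{L}}(\phi)/\operatorname{Im}D_{\mathcal{L}}(\psi)$, $[v]\mapsto[D_{\mathcal{L}}(v)]$, which carries the classes of each standard degree $e$ onto the classes of standard degree $e$. 3. Let $M$ be a fine graded submodule of $\bigoplus_{i=1}^r P(-t_i)$. Then $D_{\mathcal{L}}(M)$ is a standard graded $P$-submodule of $\bigoplus_{i=1}^r P(-d_i)$, and $M$ and $D_{\mathcal{L}}(M)$ have the same standard graded Betti numbers: both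 have minimal standard graded free resolutions by free modules of finite rank, and for all $i,j\ge0$, in any such resolution of $M$ and any such resolution of $D_{\mathcal{L}}(M)$ the $i$-th free modules have the same number of basis elements of degree $j$. -/

import Mathlib

open MvPolynomial

noncomputable section

namespace Distraction

/-- An infinite matrix `L` of polynomials in `n` indeterminates is a distraction matrix if its
entries are linear forms, any choice of one entry in each row spans the space of all linear forms,
and the columns are eventually constant. Columns are indexed from `0`: `L i j` is the entry of row
`i` in the `(j + 1)`-st column. -/
structure IsDistractionMatrix {K : Type*} [Field K] {n : ℕ}
    (L : Fin n → ℕ → MvPolynomial (Fin n) K) : Prop where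
  linear : ∀ i j, L i j ∈ homogeneousSubmodule (Fin n) K 1
  span_eq : ∀ j : Fin n → ℕ,
    Submodule.span K (Set.range fun i => L i (j i)) = homogeneousSubmodule (Fin n) K 1
  eventually_const : ∃ N : ℕ, ∀ i j, N < j → L i j = L i N

section

variable {K : Type*} [Field K] {n : ℕ}

/-- The distraction of the power product with exponent vector `a`: the product of the first `a i`
entries of each row `i`. -/
def distractPP (L : Fin n → ℕ → MvPolynomial (Fin n) K) (a : Fin n →₀ ℕ) :
    MvPolynomial (Fin n) K :=
  ∏ i, ∏ j ∈ Finset.range (a i), L i j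

/-- The symbol `f :: g`: the quotient `h` with `f = g * h` if `g` divides `f`, and `0` otherwise
(for `g ≠ 0` the quotient is unique). -/
def colon (f g : MvPolynomial (Fin n) K) : MvPolynomial (Fin n) K :=
  open Classical in if h : g ∣ f then h.choose else 0

theorem mul_colon {f g : MvPolynomial (Fin n) K} (h : g ∣ f) : g * colon f g = f := by
  rw [colon, dif_pos h]
  exact h.choose_spec.symm

theorem distractPP_dvd (L : Fin n → ℕ → MvPolynomial (Fin n) K) {a b : Fin n →₀ ℕ}
    (h : a ≤ b) : distractPP L a ∣ distractPP L b :=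
  Finset.prod_dvd_prod_of_dvd _ _ fun i _ =>
    Finset.prod_dvd_prod_of_subset _ _ _ (Finset.range_mono (h i))

/-- The `K`-linear map on `P` that sends the power product with exponent vector `s` to
`D(s + a) / D(a)`. For `a = 0` this is the distraction operator on `P`. -/
def distractTwist (L : Fin n → ℕ → MvPolynomial (Fin n) K) (a : Fin n →₀ ℕ) :
    MvPolynomial (Fin n) K →ₗ[K] MvPolynomial (Fin n) K :=
  (basisMonomials (Fin n) K).constr K fun s => colon (distractPP L (s + a)) (distractPP L a)

/-- The distraction operator on the free module `⊕ P(-tᵢ)`, i.e. on `Fin r → P` with `i`-th basis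
vector of fine degree `t i`: the `K`-linear map that sends `s eᵢ` to `D(s tᵢ) / D(tᵢ) eᵢ`. -/
def distract (L : Fin n → ℕ → MvPolynomial (Fin n) K) {r : ℕ} (t : Fin r → Fin n →₀ ℕ) :
    (Fin r → MvPolynomial (Fin n) K) →ₗ[K] (Fin r → MvPolynomial (Fin n) K) :=
  LinearMap.pi fun i => distractTwist L (t i) ∘ₗ LinearMap.proj i

/-- The vectors of `⊕ P(-tᵢ)` that are homogeneous of fine degree `d`. The shifts `t i` lie in
`ℕⁿ`, so nonzero homogeneous vectors occur only in degrees in `ℕⁿ`. -/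
def fineComponent {r : ℕ} (t : Fin r → Fin n →₀ ℕ) (d : Fin n →₀ ℕ) :
    Submodule K (Fin r → MvPolynomial (Fin n) K) where
  carrier := {v | ∀ i s, coeff s (v i) ≠ 0 → s + t i = d}
  zero_mem' := by
    intro i s h
    exact absurd (by simp) h
  add_mem' := by
    intro v w hv hw i s h
    by_cases h1 : coeff s (v i) = 0
    · exact hw i s fun h2 => h (by simp [h1, h2])
    · exact hv i s h1
  smul_mem' := by
    intro c v hv i s h
    exact hv i s fun h1 => h (by simp [h1])

/-- The vectors of `⊕ P(-dᵢ)` that are homogeneous of standard degree `e`. -/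
def stdComponent {r : ℕ} (d : Fin r → ℕ) (e : ℕ) :
    Submodule K (Fin r → MvPolynomial (Fin n) K) where
  carrier := {v | ∀ i s, coeff s (v i) ≠ 0 → s.degree + d i = e}
  zero_mem' := by
    intro i s h
    exact absurd (by simp) h
  add_mem' := by
    intro v w hv hw i s h
    by_cases h1 : coeff s (v i) = 0
    · exact hw i s fun h2 => h (by simp [h1, h2])
    · exact hv i s h1
  smul_mem' := by
    intro c v hv i s h
    exact hv i s fun h1 => h (by simp [h1])

/-- The standard degrees of the basis vectors of `⊕ P(-tᵢ)`. -/
def stdDegrees {r : ℕ} (t : Fin r → Fin n →₀ ℕ) : Fin r → ℕ := fun i => (t i).degree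

/-- A `P`-linear map of free modules that preserves the fine degree. -/
def IsFineGradedHom {r r' : ℕ} (t : Fin r → Fin n →₀ ℕ) (t' : Fin r' → Fin n →₀ ℕ)
    (φ : (Fin r → MvPolynomial (Fin n) K) →ₗ[MvPolynomial (Fin n) K]
      (Fin r' → MvPolynomial (Fin n) K)) : Prop :=
  ∀ d, ∀ v ∈ fineComponent (K := K) t d, φ v ∈ fineComponent (K := K) t' d

/-- A `P`-linear map of free modules that preserves the standard degree. -/
def IsStdGradedHom {r r' : ℕ} (d : Fin r → ℕ) (d' : Fin r' → ℕ)
    (φ : (Fin r → MvPolynomial (Fin n) K) →ₗ[MvPolynomial (Fin n) K]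
      (Fin r' → MvPolynomial (Fin n) K)) : Prop :=
  ∀ e, ∀ v ∈ stdComponent (K := K) d e, φ v ∈ stdComponent (K := K) d' e

/-- A submodule is graded if it is the sum of its intersections with the homogeneous components
of the ambient free module. -/
def IsGradedSubmodule {ι : Type*} {r : ℕ}
    (𝒜 : ι → Submodule K (Fin r → MvPolynomial (Fin n) K))
    (M : Submodule (MvPolynomial (Fin n) K) (Fin r → MvPolynomial (Fin n) K)) : Prop :=
  M.restrictScalars K = ⨆ d, 𝒜 d ⊓ M.restrictScalars K

/-- The scalar `cᵢⱼ` in the entry `mᵢⱼ = cᵢⱼ (tⱼ :: tᵢ')` of the matrix of a fine graded map. -/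
def homCoeff {r r' : ℕ} (t : Fin r → Fin n →₀ ℕ) (t' : Fin r' → Fin n →₀ ℕ)
    (φ : (Fin r → MvPolynomial (Fin n) K) →ₗ[MvPolynomial (Fin n) K]
      (Fin r' → MvPolynomial (Fin n) K)) (i : Fin r') (j : Fin r) : K :=
  coeff (t j - t' i) (LinearMap.toMatrix' φ i j)

/-- The matrix of a fine graded map has entries `cᵢⱼ (tⱼ / tᵢ')` if `tᵢ'` divides `tⱼ`, and `0`
otherwise. -/
theorem IsFineGradedHom.toMatrix'_apply {r r' : ℕ} {t : Fin r → Fin n →₀ ℕ}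
    {t' : Fin r' → Fin n →₀ ℕ}
    {φ : (Fin r → MvPolynomial (Fin n) K) →ₗ[MvPolynomial (Fin n) K]
      (Fin r' → MvPolynomial (Fin n) K)} (h : IsFineGradedHom t t' φ) (i : Fin r') (j : Fin r) :
    LinearMap.toMatrix' φ i j =
      open Classical in if t' i ≤ t j then monomial (t j - t' i) (homCoeff t t' φ i j) else 0 := by
  classical
  have h1 : Pi.single j 1 ∈ fineComponent (K := K) t (t j) := by
    intro k s hs
    by_cases hk : k = j
    · subst hk
      simp only [Pi.single_eq_same, coeff_one] at hs
      have : s = 0 := by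
        by_contra hne
        exact hs (if_neg fun h0 => hne h0.symm)
      simp [this]
    · exact absurd (by simp [Pi.single_eq_of_ne hk]) hs
  have h2 : ∀ s, coeff s (LinearMap.toMatrix' φ i j) ≠ 0 → s + t' i = t j := by
    intro s hs
    rw [LinearMap.toMatrix'_apply] at hs
    exact h (t j) _ h1 i s hs
  split_ifs with hle
  · ext s
    rw [coeff_monomial, homCoeff]
    split_ifs with hs
    · rw [hs]
    · by_contra h0
      exact hs (by rw [← h2 s h0, add_tsub_cancel_right])
  · ext s
    rw [coeff_zero]
    by_contra h0
    exact hle (by rw [← h2 s h0]; exact le_add_self)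

/-- The distraction `D(φ)` of a fine graded map `φ` with matrix `(cᵢⱼ (tⱼ :: tᵢ'))`: the `P`-linear
map with matrix `(cᵢⱼ (D(tⱼ) :: D(tᵢ')))`. -/
def distractHom (L : Fin n → ℕ → MvPolynomial (Fin n) K) {r r' : ℕ}
    (t : Fin r → Fin n →₀ ℕ) (t' : Fin r' → Fin n →₀ ℕ)
    (φ : (Fin r → MvPolynomial (Fin n) K) →ₗ[MvPolynomial (Fin n) K]
      (Fin r' → MvPolynomial (Fin n) K)) :
    (Fin r → MvPolynomial (Fin n) K) →ₗ[MvPolynomial (Fin n) K]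
      (Fin r' → MvPolynomial (Fin n) K) :=
  Matrix.mulVecLin (Matrix.of fun i j =>
    C (homCoeff t t' φ i j) * colon (distractPP L (t j)) (distractPP L (t' i)))

/-- The homology `Ker φ / Im ψ` at the middle of `ψ`, `φ` (meant for `φ ∘ ψ = 0`). -/
abbrev Homology {r'' r r' : ℕ}
    (ψ : (Fin r'' → MvPolynomial (Fin n) K) →ₗ[MvPolynomial (Fin n) K]
      (Fin r → MvPolynomial (Fin n) K))
    (φ : (Fin r → MvPolynomial (Fin n) K) →ₗ[MvPolynomial (Fin n) K]
      (Fin r' → MvPolynomial (Fin n) K)) : Type _ :=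
  LinearMap.ker φ ⧸ (LinearMap.range ψ).submoduleOf (LinearMap.ker φ)

/-- The homology classes of standard degree `e`: the classes of the cycles of standard degree `e`,
where the middle free module is `⊕ P(-dᵢ)`. -/
def homologyComponent {r'' r r' : ℕ} (d : Fin r → ℕ)
    (ψ : (Fin r'' → MvPolynomial (Fin n) K) →ₗ[MvPolynomial (Fin n) K]
      (Fin r → MvPolynomial (Fin n) K))
    (φ : (Fin r → MvPolynomial (Fin n) K) →ₗ[MvPolynomial (Fin n) K]
      (Fin r' → MvPolynomial (Fin n) K)) (e : ℕ) : Submodule K (Homology ψ φ) :=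
  ((stdComponent (K := K) d e).comap ((LinearMap.ker φ).subtype.restrictScalars K)).map
    (((LinearMap.range ψ).submoduleOf (LinearMap.ker φ)).mkQ.restrictScalars K)

/-- A minimal standard graded free resolution `⋯ → F₁ → F₀ → N → 0` of a submodule `N` of
`⊕ P(-dᵢ)`, by free modules `Fᵢ = ⊕ₖ P(-deg i k)` of finite rank; the ranks may be `0` from some
point on. Minimality says that the image of each differential `Fᵢ₊₁ → Fᵢ` lies in
`(x₁, …, xₙ) Fᵢ`. It forces the degrees of all generators to be natural numbers. -/
structure MinimalGradedFreeResolution {r : ℕ} (d : Fin r → ℕ)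
    (N : Submodule (MvPolynomial (Fin n) K) (Fin r → MvPolynomial (Fin n) K)) where
  rank : ℕ → ℕ
  deg : ∀ i, Fin (rank i) → ℕ
  aug : (Fin (rank 0) → MvPolynomial (Fin n) K) →ₗ[MvPolynomial (Fin n) K]
    (Fin r → MvPolynomial (Fin n) K)
  diff : ∀ i, (Fin (rank (i + 1)) → MvPolynomial (Fin n) K) →ₗ[MvPolynomial (Fin n) K]
    (Fin (rank i) → MvPolynomial (Fin n) K)
  aug_graded : IsStdGradedHom (deg 0) d aug
  diff_graded : ∀ i, IsStdGradedHom (deg (i + 1)) (deg i) (diff i)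
  range_aug : LinearMap.range aug = N
  exact_zero : LinearMap.ker aug = LinearMap.range (diff 0)
  exact_succ : ∀ i, LinearMap.ker (diff i) = LinearMap.range (diff (i + 1))
  minimal : ∀ i, LinearMap.range (diff i) ≤
    (Ideal.span (Set.range (X : Fin n → MvPolynomial (Fin n) K))) •
      (⊤ : Submodule (MvPolynomial (Fin n) K) (Fin (rank i) → MvPolynomial (Fin n) K))

/-- The standard graded Betti number `β i j` read off from a minimal standard graded free
resolution: the number of free generators of degree `j` in homological position `i`. -/
def MinimalGradedFreeResolution.betti {r : ℕ} {d : Fin r → ℕ}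
    {N : Submodule (MvPolynomial (Fin n) K) (Fin r → MvPolynomial (Fin n) K)}
    (R : MinimalGradedFreeResolution d N) (i j : ℕ) : ℕ :=
  (Finset.univ.filter fun k => R.deg i k = j).card

end

end Distraction

end

/-! Write `shift L a` for the distraction matrix left after deleting the first `a i` entries of row
`i`. Everything rests on D_L(a + s) = D_L(a) · D_{shift L a}(s) (`distractPP_add`): the operator on
P(-a) is the untwisted operator of `shift L a`, and D, though not P-linear, satisfies a twisted
product rule for multiplication by power products (`distractTwist_monomial_mul`).

D is bijective. It preserves degree, so surjectivity on the finite-dimensional space of forms of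
each degree suffices. A form of degree d + 1 is a combination of products ℓq with ℓ linear and q of
degree d; since the first column spans the linear forms, ℓ may be taken to be its entry in row k. By
induction q = D_{shift L e_k}(u), and then ℓq = D_L(x_k u).

The product rule, applied to each matrix entry, gives D ∘ φ = D(φ) ∘ D (`distract_hom_apply`). As D
is bijective, it carries kernels to kernels, images to images and homology to homology.

For Betti numbers, iterate minimal homogeneous covers to get a minimal fine graded resolution of M.
Its distraction is again exact, and again minimal because D preserves constant terms, so it resolves
D(M) minimally with the same ranks and degrees. A graded Nakayama argument shows that these numbers
do not depend on the minimal resolution (`MinimalGradedFreeResolution.betti_eq`). -/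

noncomputable section

namespace Distraction

/-! ### The distraction operator on the polynomial ring and its bijectivity -/

section DistractPP

variable {K : Type*} [Field K] {n : ℕ} {L : Fin n → ℕ → MvPolynomial (Fin n) K}

/-- The matrix obtained from `L` by deleting the first `a i` entries of each row `i`. -/
def shift (L : Fin n → ℕ → MvPolynomial (Fin n) K) (a : Fin n →₀ ℕ) :
    Fin n → ℕ → MvPolynomial (Fin n) K :=
  fun i j => L i (a i + j)

theorem shift_shift (L : Fin n → ℕ → MvPolynomial (Fin n) K) (a b : Fin n →₀ ℕ) :
    shift (shift L a) b = shift L (a + b) := by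
  funext i j
  simp [shift, add_assoc]

theorem IsDistractionMatrix.shift (hL : IsDistractionMatrix L) (a : Fin n →₀ ℕ) :
    IsDistractionMatrix (shift L a) where
  linear i j := hL.linear i _
  span_eq j := hL.span_eq fun i => a i + j i
  eventually_const := by
    obtain ⟨N, hN⟩ := hL.eventually_const
    -- With `N + 1` the compared column `a i + (N + 1)` lies beyond `N` even when `a i = 0`.
    refine ⟨N + 1, fun i j hj => ?_⟩
    simp only [Distraction.shift]
    rw [hN i (a i + j) (by omega), hN i (a i + (N + 1)) (by omega)]

theorem distractPP_add (L : Fin n → ℕ → MvPolynomial (Fin n) K) (a s : Fin n →₀ ℕ) :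
    distractPP L (a + s) = distractPP L a * distractPP (shift L a) s := by
  simp only [distractPP, shift, Finsupp.add_apply, Finset.prod_range_add, Finset.prod_mul_distrib]

@[simp]
theorem distractPP_zero (L : Fin n → ℕ → MvPolynomial (Fin n) K) : distractPP L 0 = 1 := by
  simp [distractPP]

theorem distractPP_single_one (L : Fin n → ℕ → MvPolynomial (Fin n) K) (k : Fin n) :
    distractPP L (Finsupp.single k 1) = L k 0 := by
  rw [distractPP, Finset.prod_eq_single k]
  · simp
  · intro i _ hi
    simp [Finsupp.single_eq_of_ne hi]
  · simp

theorem span_X_eq_homogeneousSubmodule_one :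
    Submodule.span K (Set.range (X : Fin n → MvPolynomial (Fin n) K)) =
      homogeneousSubmodule (Fin n) K 1 :=
  homogeneousSubmodule_one_eq_span_X.symm

/-- The `n` entries of a column span a space of dimension `n`, so they are linearly independent. -/
theorem IsDistractionMatrix.ne_zero (hL : IsDistractionMatrix L) (i : Fin n) (j : ℕ) :
    L i j ≠ 0 := by
  have h1 : Module.finrank K (homogeneousSubmodule (Fin n) K 1) = n := by
    rw [← span_X_eq_homogeneousSubmodule_one,
      finrank_span_eq_card (linearIndependent_X (Fin n) K), Fintype.card_fin]
  have h2 : LinearIndependent K fun k => L k j := by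
    rw [linearIndependent_iff_card_eq_finrank_span, Set.finrank, hL.span_eq fun _ => j, h1,
      Fintype.card_fin]
  exact h2.ne_zero i

theorem IsDistractionMatrix.distractPP_ne_zero (hL : IsDistractionMatrix L) (a : Fin n →₀ ℕ) :
    distractPP L a ≠ 0 :=
  Finset.prod_ne_zero_iff.2 fun i _ => Finset.prod_ne_zero_iff.2 fun j _ => hL.ne_zero i j

theorem IsDistractionMatrix.isHomogeneous_distractPP (hL : IsDistractionMatrix L)
    (a : Fin n →₀ ℕ) : (distractPP L a).IsHomogeneous a.degree := by
  rw [Finsupp.degree_eq_sum]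
  refine IsHomogeneous.prod _ _ _ fun i _ => ?_
  simpa using IsHomogeneous.prod (Finset.range (a i)) (fun j => L i j) (fun _ => 1)
    fun j _ => hL.linear i j

theorem IsDistractionMatrix.colon_distractPP_add (hL : IsDistractionMatrix L)
    (a s : Fin n →₀ ℕ) :
    colon (distractPP L (a + s)) (distractPP L a) = distractPP (Distraction.shift L a) s := by
  refine mul_left_cancel₀ (hL.distractPP_ne_zero a) ?_
  rw [mul_colon (distractPP_dvd L le_self_add), distractPP_add]

theorem IsDistractionMatrix.distractTwist_monomial (hL : IsDistractionMatrix L)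
    (a s : Fin n →₀ ℕ) (c : K) :
    distractTwist L a (monomial s c) = C c * distractPP (Distraction.shift L a) s := by
  have h : monomial s c = c • basisMonomials (Fin n) K s := by
    rw [coe_basisMonomials, smul_monomial, smul_eq_mul, mul_one]
  rw [h, map_smul, distractTwist, Module.Basis.constr_basis, add_comm, hL.colon_distractPP_add,
    smul_eq_C_mul]

/-- A twist can be absorbed into the matrix, so results proved for all distraction matrices with
twist `0` hold for every twist. -/
theorem IsDistractionMatrix.distractTwist_eq (hL : IsDistractionMatrix L) (a : Fin n →₀ ℕ) :
    distractTwist L a = distractTwist (Distraction.shift L a) 0 := by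
  refine (basisMonomials (Fin n) K).ext fun s => ?_
  rw [coe_basisMonomials, hL.distractTwist_monomial, (hL.shift a).distractTwist_monomial,
    shift_shift, add_zero]

/-- This replaces P-linearity: pulling out a power product `s` moves the twist from `a` to `a + s`.
-/
theorem IsDistractionMatrix.distractTwist_monomial_mul (hL : IsDistractionMatrix L)
    (a s : Fin n →₀ ℕ) (p : MvPolynomial (Fin n) K) :
    distractTwist L a (monomial s 1 * p) =
      distractPP (Distraction.shift L a) s * distractTwist L (a + s) p := by
  induction p using MvPolynomial.induction_on' with
  | monomial u c =>
    rw [monomial_mul, one_mul, hL.distractTwist_monomial, hL.distractTwist_monomial,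
      distractPP_add, shift_shift]
    ring
  | add p q hp hq => rw [mul_add, map_add, hp, hq, map_add, mul_add]

theorem IsDistractionMatrix.isHomogeneous_distractTwist (hL : IsDistractionMatrix L)
    (a : Fin n →₀ ℕ) {d : ℕ} {p : MvPolynomial (Fin n) K} (hp : p.IsHomogeneous d) :
    (distractTwist L a p).IsHomogeneous d := by
  rw [p.as_sum, map_sum]
  refine IsHomogeneous.sum _ _ _ fun s hs => ?_
  rw [hL.distractTwist_monomial]
  have hd : d = s.degree := hp.degree_eq_sum_deg_support hs
  rw [hd]
  exact ((hL.shift a).isHomogeneous_distractPP s).C_mul _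

/-- A nonconstant power product goes to a form of positive degree, and `1` goes to `1`. This is what
keeps distracted resolutions minimal. -/
theorem IsDistractionMatrix.constantCoeff_distractTwist (hL : IsDistractionMatrix L)
    (a : Fin n →₀ ℕ) (p : MvPolynomial (Fin n) K) :
    constantCoeff (distractTwist L a p) = constantCoeff p := by
  induction p using MvPolynomial.induction_on' with
  | monomial u c =>
    rw [hL.distractTwist_monomial, map_mul, constantCoeff_C, constantCoeff_monomial]
    split_ifs with h
    · simp [h]
    · rw [constantCoeff_eq,
        ((hL.shift a).isHomogeneous_distractPP u).coeff_eq_zero (d := 0), mul_zero]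
      rw [map_zero]
      exact fun h0 => h ((Finsupp.degree_eq_zero_iff u).1 h0.symm)
  | add p q hp hq => rw [map_add, map_add, hp, hq, map_add]

/-- Surjectivity in degree `d`. The matrix is quantified inside the induction because the step for
`L` uses the hypothesis for `shift L (Finsupp.single k 1)`. -/
theorem IsDistractionMatrix.le_map_distractTwist (d : ℕ) :
    ∀ {L : Fin n → ℕ → MvPolynomial (Fin n) K}, IsDistractionMatrix L →
      homogeneousSubmodule (Fin n) K d ≤
        (homogeneousSubmodule (Fin n) K d).map (distractTwist L 0) := by
  induction d with
  | zero =>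
    intro L hL p hp
    obtain ⟨c, rfl⟩ : ∃ c, p = C c := ⟨_, totalDegree_eq_zero_iff_eq_C.1 (Nat.le_zero.1
      (IsHomogeneous.totalDegree_le hp))⟩
    refine ⟨C c, isHomogeneous_C _ _, ?_⟩
    rw [C_apply, hL.distractTwist_monomial, distractPP_zero, mul_one, C_apply]
  | succ d ih =>
    intro L hL p hp
    have key : ∀ q : MvPolynomial (Fin n) K, q.IsHomogeneous d → ∀ ℓ ∈
        homogeneousSubmodule (Fin n) K 1,
        ℓ * q ∈ (homogeneousSubmodule (Fin n) K (d + 1)).map (distractTwist L 0) := by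
      intro q hq ℓ hℓ
      rw [← hL.span_eq fun _ => 0] at hℓ
      induction hℓ using Submodule.span_induction with
      | mem x hx =>
        obtain ⟨k, rfl⟩ := hx
        obtain ⟨u, hu, rfl⟩ := ih (hL.shift (Finsupp.single k 1)) hq
        refine ⟨X k * u, ?_, ?_⟩
        · rw [add_comm]
          exact (isHomogeneous_X K k).mul hu
        · rw [X, hL.distractTwist_monomial_mul, hL.distractTwist_eq, distractPP_single_one,
            zero_add]
          simp [Distraction.shift]
      | zero => simp
      | add x y _ _ hx hy => rw [add_mul]; exact add_mem hx hy
      | smul c x _ hx => rw [smul_mul_assoc]; exact Submodule.smul_mem _ _ hx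
    rw [p.as_sum]
    refine sum_mem fun s hs => ?_
    have hdeg : s.degree = d + 1 := (IsHomogeneous.degree_eq_sum_deg_support hp hs).symm
    obtain ⟨k, hk⟩ : ∃ k, s k ≠ 0 := by
      by_contra! h
      have : s = 0 := Finsupp.ext h
      simp [this] at hdeg
    have hle : Finsupp.single k 1 ≤ s := by
      rw [Finsupp.single_le_iff]
      omega
    have hs' : s = Finsupp.single k 1 + (s - Finsupp.single k 1) :=
      (add_tsub_cancel_of_le hle).symm
    have hm : monomial s (coeff s p) =
        X k * monomial (s - Finsupp.single k 1) (coeff s p) := by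
      rw [X, monomial_mul, one_mul, ← hs']
    rw [hm]
    refine key _ (isHomogeneous_monomial _ ?_) _ (isHomogeneous_X K k)
    have := congrArg Finsupp.degree hs'
    rw [map_add, Finsupp.degree_single] at this
    omega

theorem IsDistractionMatrix.bijective_distractTwist (hL : IsDistractionMatrix L)
    (a : Fin n →₀ ℕ) : Function.Bijective (distractTwist L a) := by
  have hsurj := fun d => (hL.shift a).le_map_distractTwist d
  rw [← hL.distractTwist_eq] at hsurj
  constructor
  · rw [injective_iff_map_eq_zero]
    intro p hp
    have hcomp : ∀ d, homogeneousComponent d p = 0 := by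
      intro d
      have hfin : FiniteDimensional K (homogeneousSubmodule (Fin n) K d) :=
        Module.Finite.iff_fg.2 (homogeneousSubmodule_fg _ _ d)
      let f : homogeneousSubmodule (Fin n) K d →ₗ[K] homogeneousSubmodule (Fin n) K d :=
        (distractTwist L a).restrict fun q hq => hL.isHomogeneous_distractTwist a hq
      have hf : Function.Injective f := by
        -- A surjective endomorphism of a finite-dimensional space is injective.
        rw [LinearMap.injective_iff_surjective]
        rintro ⟨q, hq⟩
        obtain ⟨u, hu, rfl⟩ := hsurj d hq
        exact ⟨⟨u, hu⟩, rfl⟩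
      have h0 : distractTwist L a (homogeneousComponent d p) = 0 := by
        have h1 := congrArg (homogeneousComponent d) hp
        rw [map_zero] at h1
        conv_lhs at h1 => rw [← sum_homogeneousComponent p, map_sum, map_sum]
        by_cases hd : d ∈ Finset.range (p.totalDegree + 1)
        · rw [Finset.sum_eq_single_of_mem d hd, homogeneousComponent_eq_self] at h1
          · exact h1
          · exact hL.isHomogeneous_distractTwist a (homogeneousComponent_isHomogeneous d p)
          · intro e _ he
            rw [homogeneousComponent_of_mem
              (hL.isHomogeneous_distractTwist a (homogeneousComponent_isHomogeneous e p)),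
              if_neg he.symm]
        · rw [homogeneousComponent_eq_zero, map_zero]
          simpa [Nat.lt_succ_iff] using hd
      have := @hf ⟨_, homogeneousComponent_isHomogeneous d p⟩ 0 (Subtype.ext h0)
      exact congrArg Subtype.val this
    rw [← sum_homogeneousComponent p]
    exact Finset.sum_eq_zero fun d _ => hcomp d
  · rw [← LinearMap.range_eq_top, eq_top_iff]
    intro p _
    rw [← sum_homogeneousComponent p]
    refine sum_mem fun d _ => ?_
    obtain ⟨u, -, hu⟩ := hsurj d (homogeneousComponent_isHomogeneous d p)
    exact ⟨u, hu⟩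

end DistractPP

/-! ### Graded free modules; `w = id` gives the fine grading and `w = degree` the standard one -/

section Graded

variable {K : Type*} [Field K] {n : ℕ} {A : Type*} [AddCommMonoid A]

/-- The vectors of the free module with basis vectors of degrees `t i` that are homogeneous of
degree `d`, where the power product with exponent vector `s` has degree `w s`. -/
def gradedComponent (w : (Fin n →₀ ℕ) →+ A) {r : ℕ} (t : Fin r → A) (d : A) :
    Submodule K (Fin r → MvPolynomial (Fin n) K) where
  carrier := {v | ∀ i s, coeff s (v i) ≠ 0 → w s + t i = d}
  zero_mem' := by
    intro i s h
    exact absurd (by simp) h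
  add_mem' := by
    intro v u hv hu i s h
    by_cases h1 : coeff s (v i) = 0
    · exact hu i s fun h2 => h (by simp [h1, h2])
    · exact hv i s h1
  smul_mem' := by
    intro c v hv i s h
    exact hv i s fun h1 => h (by simp [h1])

/-- The projection of a free module onto its homogeneous component of degree `d`. -/
def gradedProj (w : (Fin n →₀ ℕ) →+ A) {r : ℕ} (t : Fin r → A) (d : A) :
    (Fin r → MvPolynomial (Fin n) K) →ₗ[K] (Fin r → MvPolynomial (Fin n) K) :=
  open Classical in LinearMap.pi fun i => (basisMonomials (Fin n) K).constr K
    (fun s => if w s + t i = d then monomial s 1 else 0) ∘ₗ LinearMap.proj i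

open Classical in
theorem coeff_gradedProj (w : (Fin n →₀ ℕ) →+ A) {r : ℕ} (t : Fin r → A) (d : A)
    (v : Fin r → MvPolynomial (Fin n) K) (i : Fin r) (s : Fin n →₀ ℕ) :
    coeff s (gradedProj w t d v i) = if w s + t i = d then coeff s (v i) else 0 := by
  simp only [gradedProj, LinearMap.pi_apply, LinearMap.comp_apply, LinearMap.proj_apply]
  generalize v i = p
  induction p using MvPolynomial.induction_on' with
  | monomial u c =>
    have h : monomial u c = c • basisMonomials (Fin n) K u := by
      rw [coe_basisMonomials, smul_monomial, smul_eq_mul, mul_one]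
    rw [h, map_smul, Module.Basis.constr_basis, ← h, coeff_smul, coeff_monomial]
    by_cases hs : u = s
    · subst hs
      by_cases hd : w u + t i = d <;> simp [hd]
    · by_cases hd : w s + t i = d <;> by_cases hd' : w u + t i = d <;>
        simp [hd, hd', hs, coeff_monomial]
  | add p q hp hq =>
    rw [map_add, coeff_add, hp, hq, coeff_add]
    split_ifs <;> simp

variable {w : (Fin n →₀ ℕ) →+ A} {r r' r'' : ℕ} {t : Fin r → A} {t' : Fin r' → A}
  {t'' : Fin r'' → A}

theorem gradedProj_mem (d : A) (v : Fin r → MvPolynomial (Fin n) K) :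
    gradedProj w t d v ∈ gradedComponent w t d := by
  intro i s h
  rw [coeff_gradedProj] at h
  by_contra h0
  exact h (if_neg h0)

theorem gradedProj_of_mem {d : A} {v : Fin r → MvPolynomial (Fin n) K}
    (hv : v ∈ gradedComponent w t d) : gradedProj w t d v = v := by
  funext i
  ext s
  rw [coeff_gradedProj]
  split_ifs with h
  · rfl
  · by_contra h0
    exact h (hv i s (Ne.symm h0))

theorem gradedProj_of_mem_of_ne {d e : A} (hde : d ≠ e) {v : Fin r → MvPolynomial (Fin n) K}
    (hv : v ∈ gradedComponent w t d) : gradedProj w t e v = 0 := by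
  funext i
  ext s
  rw [coeff_gradedProj, Pi.zero_apply, coeff_zero]
  split_ifs with h
  · by_contra h0
    exact hde ((hv i s h0).symm.trans h)
  · rfl

/-- Allowing every larger `T` lets a prescribed degree be adjoined to the index set. -/
theorem exists_sum_gradedProj (w : (Fin n →₀ ℕ) →+ A) (t : Fin r → A)
    (v : Fin r → MvPolynomial (Fin n) K) :
    ∃ S : Finset A, ∀ T, S ⊆ T → ∑ d ∈ T, gradedProj w t d v = v := by
  classical
  refine ⟨Finset.univ.biUnion fun i => (v i).support.image fun s => w s + t i, fun T hT => ?_⟩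
  funext i
  ext s
  rw [Finset.sum_apply, coeff_sum]
  simp only [coeff_gradedProj]
  rw [Finset.sum_ite_eq]
  split_ifs with h
  · rfl
  · by_contra h0
    refine h (hT ?_)
    simp only [Finset.mem_biUnion, Finset.mem_univ, true_and, Finset.mem_image, mem_support_iff]
    exact ⟨i, s, Ne.symm h0, rfl⟩

theorem map_gradedProj
    {f : (Fin r → MvPolynomial (Fin n) K) →ₗ[K] (Fin r' → MvPolynomial (Fin n) K)}
    (hf : ∀ d, ∀ v ∈ gradedComponent w t d, f v ∈ gradedComponent w t' d) (d : A)
    (v : Fin r → MvPolynomial (Fin n) K) :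
    f (gradedProj w t d v) = gradedProj w t' d (f v) := by
  classical
  obtain ⟨S, hS⟩ := exists_sum_gradedProj w t v
  conv_rhs => rw [← hS (insert d S) (Finset.subset_insert _ _), map_sum, map_sum]
  rw [Finset.sum_eq_single_of_mem d (Finset.mem_insert_self _ _),
    gradedProj_of_mem (hf _ _ (gradedProj_mem d v))]
  exact fun e _ he => gradedProj_of_mem_of_ne he (hf _ _ (gradedProj_mem e v))

theorem isGradedSubmodule_iff
    {M : Submodule (MvPolynomial (Fin n) K) (Fin r → MvPolynomial (Fin n) K)} :
    IsGradedSubmodule (gradedComponent w t) M ↔ ∀ v ∈ M, ∀ d, gradedProj w t d v ∈ M := by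
  constructor
  · intro h v hv d
    have hv' : v ∈ M.restrictScalars K := hv
    clear hv
    rw [h] at hv'
    induction hv' using Submodule.iSup_induction' with
    | mem e x hx =>
      by_cases hde : e = d
      · subst hde
        rw [gradedProj_of_mem hx.1]
        exact hx.2
      · rw [gradedProj_of_mem_of_ne hde hx.1]
        exact zero_mem _
    | zero => simp
    | add x y _ _ hx hy => rw [map_add]; exact add_mem hx hy
  · intro h
    refine le_antisymm (fun v hv => ?_) (iSup_le fun d => inf_le_right)
    obtain ⟨S, hS⟩ := exists_sum_gradedProj w t v
    rw [← hS S subset_rfl]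
    exact sum_mem fun d _ => Submodule.mem_iSup_of_mem d ⟨gradedProj_mem d v, h v hv d⟩

/-- A linear map of free modules that preserves the degree. -/
def IsGradedHom (w : (Fin n →₀ ℕ) →+ A) (t : Fin r → A) (t' : Fin r' → A)
    (φ : (Fin r → MvPolynomial (Fin n) K) →ₗ[MvPolynomial (Fin n) K]
      (Fin r' → MvPolynomial (Fin n) K)) : Prop :=
  ∀ d, ∀ v ∈ gradedComponent (K := K) w t d, φ v ∈ gradedComponent (K := K) w t' d

variable {φ : (Fin r → MvPolynomial (Fin n) K) →ₗ[MvPolynomial (Fin n) K]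
      (Fin r' → MvPolynomial (Fin n) K)}

theorem IsGradedHom.map_proj (h : IsGradedHom w t t' φ) (d : A)
    (v : Fin r → MvPolynomial (Fin n) K) :
    φ (gradedProj w t d v) = gradedProj w t' d (φ v) :=
  map_gradedProj (f := φ.restrictScalars K) h d v

theorem IsGradedHom.comp {χ : (Fin r' → MvPolynomial (Fin n) K) →ₗ[MvPolynomial (Fin n) K]
      (Fin r'' → MvPolynomial (Fin n) K)} (hχ : IsGradedHom w t' t'' χ)
    (hφ : IsGradedHom w t t' φ) : IsGradedHom w t t'' (χ ∘ₗ φ) :=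
  fun d v hv => hχ d _ (hφ d v hv)

theorem IsGradedHom.isGradedSubmodule_ker (h : IsGradedHom w t t' φ) :
    IsGradedSubmodule (gradedComponent w t) (LinearMap.ker φ) := by
  refine isGradedSubmodule_iff.2 fun v hv d => ?_
  rw [LinearMap.mem_ker] at hv ⊢
  rw [h.map_proj, hv, map_zero]

theorem IsGradedHom.isGradedSubmodule_range (h : IsGradedHom w t t' φ) :
    IsGradedSubmodule (gradedComponent w t') (LinearMap.range φ) := by
  refine isGradedSubmodule_iff.2 ?_
  rintro _ ⟨v, rfl⟩ d
  exact ⟨gradedProj w t d v, h.map_proj d v⟩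

theorem single_mem_gradedComponent (w : (Fin n →₀ ℕ) →+ A) (t : Fin r → A) (k : Fin r) :
    Pi.single k 1 ∈ gradedComponent (K := K) w t (t k) := by
  classical
  intro i s hs
  by_cases hi : i = k
  · subst hi
    simp only [Pi.single_eq_same, coeff_one] at hs
    have : s = 0 := by
      by_contra hne
      exact hs (if_neg fun h0 => hne h0.symm)
    simp [this]
  · exact absurd (by simp [Pi.single_eq_of_ne hi]) hs

theorem isGradedHom_of_single
    (h : ∀ k, φ (Pi.single k 1) ∈ gradedComponent (K := K) w t' (t k)) :
    IsGradedHom w t t' φ := by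
  classical
  intro d v hv
  have hsum : φ v = ∑ k, v k • φ (Pi.single k 1) := by
    conv_lhs => rw [← (Pi.basisFun (MvPolynomial (Fin n) K) (Fin r)).sum_repr v, map_sum]
    simp
  rw [hsum]
  refine sum_mem fun k _ i s hs => ?_
  rw [Pi.smul_apply, smul_eq_mul, coeff_mul] at hs
  obtain ⟨⟨a, b⟩, hab, hne⟩ := Finset.exists_ne_zero_of_sum_ne_zero hs
  rw [← Finset.HasAntidiagonal.mem_antidiagonal.1 hab, map_add, add_assoc,
    h k i b (right_ne_zero_of_mul hne), hv k a (left_ne_zero_of_mul hne)]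

/-- The linear map that sends the basis vectors to the vectors `u k`. -/
def homOfVectors (u : Fin r → Fin r' → MvPolynomial (Fin n) K) :
    (Fin r → MvPolynomial (Fin n) K) →ₗ[MvPolynomial (Fin n) K]
      (Fin r' → MvPolynomial (Fin n) K) :=
  (Pi.basisFun (MvPolynomial (Fin n) K) (Fin r)).constr (MvPolynomial (Fin n) K) u

@[simp]
theorem homOfVectors_single (u : Fin r → Fin r' → MvPolynomial (Fin n) K) (k : Fin r) :
    homOfVectors u (Pi.single k 1) = u k := by
  classical
  rw [← Pi.basisFun_apply, homOfVectors, Module.Basis.constr_basis]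

theorem homOfVectors_apply (u : Fin r → Fin r' → MvPolynomial (Fin n) K)
    (v : Fin r → MvPolynomial (Fin n) K) : homOfVectors u v = ∑ k, v k • u k := by
  simp [homOfVectors, Module.Basis.constr_apply_fintype]

theorem range_homOfVectors (u : Fin r → Fin r' → MvPolynomial (Fin n) K) :
    LinearMap.range (homOfVectors u) =
      Submodule.span (MvPolynomial (Fin n) K) (Set.range u) :=
  Module.Basis.constr_range _ _

theorem hom_ext_single {χ : (Fin r → MvPolynomial (Fin n) K) →ₗ[MvPolynomial (Fin n) K]
      (Fin r' → MvPolynomial (Fin n) K)}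
    (h : ∀ k, φ (Pi.single k 1) = χ (Pi.single k 1)) : φ = χ := by
  classical
  refine (Pi.basisFun (MvPolynomial (Fin n) K) (Fin r)).ext fun k => ?_
  rw [Pi.basisFun_apply, h]

/-- Turns minimality of a resolution into a condition on constant terms. -/
theorem mem_span_X_smul_top_iff {v : Fin r → MvPolynomial (Fin n) K} :
    v ∈ (Ideal.span (Set.range (X : Fin n → MvPolynomial (Fin n) K))) •
      (⊤ : Submodule (MvPolynomial (Fin n) K) (Fin r → MvPolynomial (Fin n) K)) ↔
      ∀ i, constantCoeff (v i) = 0 := by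
  classical
  have hX : ∀ p : MvPolynomial (Fin n) K,
      p ∈ Ideal.span (Set.range (X : Fin n → MvPolynomial (Fin n) K)) ↔
        constantCoeff p = 0 := by
    intro p
    rw [← Set.image_univ, mem_ideal_span_X_image, constantCoeff_eq]
    constructor
    · intro h
      by_contra h0
      obtain ⟨i, -, hi⟩ := h 0 (mem_support_iff.2 h0)
      exact hi rfl
    · intro h s hs
      by_contra! h0
      have : s = 0 := Finsupp.ext fun i => h0 i trivial
      exact mem_support_iff.1 hs (this ▸ h)
  constructor
  · intro h
    refine Submodule.smul_induction_on h ?_ ?_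
    · intro p hp u _ i
      rw [Pi.smul_apply, smul_eq_mul, map_mul, (hX p).1 hp, zero_mul]
    · intro x y hx hy i
      rw [Pi.add_apply, map_add, hx, hy, add_zero]
  · intro h
    rw [pi_eq_sum_univ v]
    exact sum_mem fun i _ => Submodule.smul_mem_smul ((hX _).2 (h i)) trivial

end Graded

/-! ### Minimal homogeneous generators and graded lifts -/

section Generators

variable {K : Type*} [Field K] {n : ℕ} {A : Type*} [AddCommMonoid A]
  {w : (Fin n →₀ ℕ) →+ A} {r r' : ℕ} {t : Fin r → A} {t' : Fin r' → A}

theorem exists_homogeneous_generators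
    {M : Submodule (MvPolynomial (Fin n) K) (Fin r → MvPolynomial (Fin n) K)}
    (hM : IsGradedSubmodule (gradedComponent w t) M) :
    ∃ (m : ℕ) (a : Fin m → A) (u : Fin m → Fin r → MvPolynomial (Fin n) K),
      (∀ k, u k ∈ gradedComponent w t (a k)) ∧
        Submodule.span (MvPolynomial (Fin n) K) (Set.range u) = M := by
  set H : Set (Fin r → MvPolynomial (Fin n) K) := {v | v ∈ M ∧ ∃ d, v ∈ gradedComponent w t d}
    with hH
  have hspan : Submodule.span (MvPolynomial (Fin n) K) H = M := by
    refine le_antisymm (Submodule.span_le.2 fun v hv => hv.1) fun v hv => ?_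
    obtain ⟨S, hS⟩ := exists_sum_gradedProj w t v
    rw [← hS S subset_rfl]
    exact sum_mem fun d _ => Submodule.subset_span
      ⟨isGradedSubmodule_iff.1 hM v hv d, d, gradedProj_mem d v⟩
  have hfg : (Submodule.span (MvPolynomial (Fin n) K) H).FG := IsNoetherian.noetherian _
  obtain ⟨S, hSH, hS⟩ := (Submodule.fg_span_iff_fg_span_finset_subset H).1 hfg
  choose a ha using fun k : Fin S.card => (hSH (S.equivFin.symm k).2).2
  refine ⟨S.card, a, fun k => (S.equivFin.symm k : Fin r → MvPolynomial (Fin n) K), ha, ?_⟩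
  rw [← hspan, hS]
  congr 1
  ext v
  constructor
  · rintro ⟨k, rfl⟩
    exact (S.equivFin.symm k).2
  · intro hv
    exact ⟨S.equivFin ⟨v, hv⟩, by simp⟩

/-- A graded submodule has a system of homogeneous generators all of whose relations have
coefficients without constant term. -/
theorem exists_minimal_generators [IsCancelAdd A] (hw : ∀ s, w s = 0 → s = 0)
    {M : Submodule (MvPolynomial (Fin n) K) (Fin r → MvPolynomial (Fin n) K)}
    (hM : IsGradedSubmodule (gradedComponent w t) M) :
    ∃ (m : ℕ) (a : Fin m → A)
      (φ : (Fin m → MvPolynomial (Fin n) K) →ₗ[MvPolynomial (Fin n) K]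
        (Fin r → MvPolynomial (Fin n) K)),
      IsGradedHom w a t φ ∧ LinearMap.range φ = M ∧
        ∀ v ∈ LinearMap.ker φ, ∀ k, constantCoeff (v k) = 0 := by
  classical
  have hex := exists_homogeneous_generators hM
  -- Take the least possible number of homogeneous generators. A relation with a nonzero constant
  -- term at `k` would make the generator `u k` redundant.
  obtain ⟨a, u, hu, hspan⟩ := Nat.find_spec hex
  have hgr : IsGradedHom w a t (homOfVectors u) := isGradedHom_of_single fun k => by
    rw [homOfVectors_single]
    exact hu k
  refine ⟨Nat.find hex, a, homOfVectors u, hgr, by rw [range_homOfVectors, hspan],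
    fun v hv k => ?_⟩
  by_contra hc
  have hv' := isGradedSubmodule_iff.1 hgr.isGradedSubmodule_ker v hv (a k)
  set y := gradedProj w a (a k) v with hy
  -- In the degree `a k` part of the relation, the coefficient of `u k` has degree zero, so by `hw`
  -- it is a scalar, hence a unit.
  have hyk : y k = C (constantCoeff (v k)) := by
    ext s
    rw [hy, coeff_gradedProj, coeff_C, constantCoeff_eq]
    by_cases hs : s = 0
    · simp [hs]
    · rw [if_neg (fun h => hs (hw s (add_eq_right.1 h))), if_neg (Ne.symm hs)]
  have hmin := fun m (h : m < Nat.find hex) => Nat.find_min hex h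
  generalize Nat.find hex = N at *
  obtain _ | m := N
  · exact k.elim0
  refine hmin m (Nat.lt_succ_self m) ⟨fun l => a (k.succAbove l), fun l => u (k.succAbove l),
    fun l => hu _, ?_⟩
  set T := Submodule.span (MvPolynomial (Fin n) K) (Set.range fun l => u (k.succAbove l)) with hT
  have hsub : ∀ l, u (k.succAbove l) ∈ T := fun l => Submodule.subset_span ⟨l, rfl⟩
  have huk : u k ∈ T := by
    rw [LinearMap.mem_ker, homOfVectors_apply, Fin.sum_univ_succAbove _ k, hyk] at hv'
    have h1 : (C (constantCoeff (v k)) : MvPolynomial (Fin n) K) • u k ∈ T := by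
      rw [eq_neg_of_add_eq_zero_left hv']
      exact neg_mem (sum_mem fun l _ => T.smul_mem _ (hsub l))
    have h2 := T.smul_mem (C (constantCoeff (v k))⁻¹) h1
    rwa [smul_smul, ← map_mul, inv_mul_cancel₀ hc, map_one, one_smul] at h2
  rw [← hspan]
  refine le_antisymm (Submodule.span_mono ?_) (Submodule.span_le.2 ?_)
  · rintro _ ⟨l, rfl⟩
    exact ⟨_, rfl⟩
  · rintro _ ⟨l, rfl⟩
    obtain rfl | ⟨l, rfl⟩ := Fin.eq_self_or_eq_succAbove k l
    · exact huk
    · exact hsub l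

/-- Projectivity of free modules in graded form: a preimage of the image of a basis vector is
replaced by its component of the right degree. -/
theorem exists_graded_lift {r₀ : ℕ} {t₀ : Fin r₀ → A}
    {α : (Fin r → MvPolynomial (Fin n) K) →ₗ[MvPolynomial (Fin n) K]
      (Fin r₀ → MvPolynomial (Fin n) K)}
    {α' : (Fin r' → MvPolynomial (Fin n) K) →ₗ[MvPolynomial (Fin n) K]
      (Fin r₀ → MvPolynomial (Fin n) K)}
    (hα : IsGradedHom w t t₀ α) (hα' : IsGradedHom w t' t₀ α')
    (h : LinearMap.range α ≤ LinearMap.range α') :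
    ∃ Θ : (Fin r → MvPolynomial (Fin n) K) →ₗ[MvPolynomial (Fin n) K]
      (Fin r' → MvPolynomial (Fin n) K), IsGradedHom w t t' Θ ∧ α' ∘ₗ Θ = α := by
  have hex : ∀ k, ∃ y ∈ gradedComponent w t' (t k), α' y = α (Pi.single k 1) := by
    intro k
    obtain ⟨y, hy⟩ := h ⟨Pi.single k 1, rfl⟩
    refine ⟨gradedProj w t' (t k) y, gradedProj_mem _ _, ?_⟩
    rw [hα'.map_proj, hy, gradedProj_of_mem (hα _ _ (single_mem_gradedComponent w t k))]
  choose y hy hαy using hex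
  refine ⟨homOfVectors y, isGradedHom_of_single fun k => ?_, hom_ext_single fun k => ?_⟩
  · rw [homOfVectors_single]
    exact hy k
  · rw [LinearMap.comp_apply, homOfVectors_single, hαy]

/-- Modulo (x₁, …, xₙ) a graded map becomes a block matrix over `K`, one block for each degree. The
degree `j` block of `Θ` has a left inverse, so it has at least as many rows as columns. -/
theorem card_le_card_of_comp_congr_id
    {Θ : (Fin r → MvPolynomial (Fin n) K) →ₗ[MvPolynomial (Fin n) K]
      (Fin r' → MvPolynomial (Fin n) K)}
    {Θ' : (Fin r' → MvPolynomial (Fin n) K) →ₗ[MvPolynomial (Fin n) K]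
      (Fin r → MvPolynomial (Fin n) K)}
    (hΘ : IsGradedHom w t t' Θ)
    (h : ∀ v i, constantCoeff ((Θ' (Θ v) - v) i) = 0) (j : A) [DecidableEq A] :
    (Finset.univ.filter fun k => t k = j).card ≤ (Finset.univ.filter fun k => t' k = j).card := by
  classical
  let F : Matrix {l // t' l = j} {k // t k = j} K :=
    Matrix.of fun l k => constantCoeff (Θ (Pi.single k.1 1) l.1)
  let B : Matrix {k // t k = j} {l // t' l = j} K :=
    Matrix.of fun k l => constantCoeff (Θ' (Pi.single l.1 1) k.1)
  have hBF : B * F = 1 := by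
    ext i k
    have h1 := h (Pi.single k.1 1) i.1
    rw [Pi.sub_apply, map_sub, sub_eq_zero] at h1
    have h2 : Θ' (Θ (Pi.single k.1 1)) =
        ∑ l, Θ (Pi.single k.1 1) l • Θ' (Pi.single l 1) := by
      conv_lhs => rw [← (Pi.basisFun (MvPolynomial (Fin n) K) (Fin r')).sum_repr
        (Θ (Pi.single k.1 1)), map_sum]
      simp
    rw [h2, Finset.sum_apply, map_sum] at h1
    have h3 : (1 : Matrix {k // t k = j} {k // t k = j} K) i k =
        constantCoeff ((Pi.single k.1 1 : Fin r → MvPolynomial (Fin n) K) i.1) := by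
      by_cases hik : i = k
      · rw [hik, Matrix.one_apply_eq, Pi.single_eq_same, map_one]
      · rw [Matrix.one_apply_ne hik, Pi.single_eq_of_ne (fun h0 => hik (Subtype.ext h0)), map_zero]
    rw [h3, ← h1, Matrix.mul_apply]
    rw [← Finset.sum_subset (Finset.filter_subset (fun l => t' l = j) Finset.univ),
      Finset.sum_subtype (p := fun l => t' l = j) _ (by simp)]
    · refine Finset.sum_congr rfl fun l _ => ?_
      simp only [B, F, Matrix.of_apply, Pi.smul_apply, smul_eq_mul, map_mul]
      ring
    · intro l _ hl
      rw [Pi.smul_apply, smul_eq_mul, map_mul]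
      -- A constant entry can only join basis vectors of equal degree.
      have : constantCoeff (Θ (Pi.single k.1 1) l) = 0 := by
        by_contra h0
        have := hΘ _ _ (single_mem_gradedComponent w t k.1) l 0 h0
        rw [map_zero, zero_add] at this
        exact hl (by simp [this, k.2])
      rw [this, zero_mul]
  have hinj : Function.Injective F.mulVecLin := by
    refine Function.LeftInverse.injective (g := B.mulVecLin) fun v => ?_
    simp [hBF]
  have := LinearMap.finrank_le_finrank_of_injective hinj
  simpa [Module.finrank_fintype_fun_eq_card, Fintype.card_subtype] using this

end Generators

/-! ### Uniqueness of graded Betti numbers -/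

section Standard

variable {K : Type*} [Field K] {n : ℕ} {r r' : ℕ} {d : Fin r → ℕ} {d' : Fin r' → ℕ}

/-- Graded Nakayama: the error `Γ eₖ - eₖ` has no constant terms, so for degree reasons it involves
only basis vectors of degree below `d k`. Strong induction gives surjectivity, and the Noetherian
property gives injectivity. -/
theorem IsStdGradedHom.bijective_of_congr_id
    {Γ : (Fin r → MvPolynomial (Fin n) K) →ₗ[MvPolynomial (Fin n) K]
      (Fin r → MvPolynomial (Fin n) K)}
    (hΓ : IsStdGradedHom d d Γ) (h : ∀ v i, constantCoeff ((Γ v - v) i) = 0) :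
    Function.Bijective Γ := by
  classical
  have hsurj : Function.Surjective Γ := by
    have key : ∀ e k, d k = e → Pi.single k 1 ∈ LinearMap.range Γ := by
      intro e
      induction e using Nat.strong_induction_on with
      | _ e ih =>
        intro k hk
        have hek := single_mem_gradedComponent (K := K) (Finsupp.degree : (Fin n →₀ ℕ) →+ ℕ) d k
        set y := Γ (Pi.single k 1) - Pi.single k 1 with hy
        have hmem : y ∈ stdComponent d e := hk ▸ sub_mem (hΓ _ _ hek) hek
        have hyr : y ∈ LinearMap.range Γ := by
          have hsum : y = ∑ i, y i • Pi.single i (1 : MvPolynomial (Fin n) K) :=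
            ((Pi.basisFun (MvPolynomial (Fin n) K) (Fin r)).sum_repr y).symm.trans (by simp)
          rw [hsum]
          refine sum_mem fun i _ => ?_
          by_cases h0 : y i = 0
          · rw [h0, zero_smul]
            exact zero_mem _
          · obtain ⟨s, hs⟩ := ne_zero_iff.1 h0
            refine Submodule.smul_mem _ _ (ih (d i) ?_ i rfl)
            have h1 := hmem i s hs
            have h2 : s ≠ 0 := by
              rintro rfl
              exact hs (h _ i)
            have h3 := (Finsupp.degree_eq_zero_iff s).not.2 h2
            omega
        have : Pi.single k 1 = Γ (Pi.single k 1) - y := by rw [hy]; abel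
        rw [this]
        exact sub_mem ⟨_, rfl⟩ hyr
    rw [← LinearMap.range_eq_top, eq_top_iff, ← (Pi.basisFun _ _).span_eq, Submodule.span_le]
    rintro _ ⟨k, rfl⟩
    rw [Pi.basisFun_apply]
    exact key _ k rfl
  exact ⟨IsNoetherian.injective_of_surjective_endomorphism Γ hsurj, hsurj⟩

/-- Two minimal graded presentations of the same graded module are isomorphic. -/
theorem exists_graded_equiv_of_minimal {r₀ : ℕ} {d₀ : Fin r₀ → ℕ}
    {α : (Fin r → MvPolynomial (Fin n) K) →ₗ[MvPolynomial (Fin n) K]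
      (Fin r₀ → MvPolynomial (Fin n) K)}
    {α' : (Fin r' → MvPolynomial (Fin n) K) →ₗ[MvPolynomial (Fin n) K]
      (Fin r₀ → MvPolynomial (Fin n) K)}
    (hα : IsStdGradedHom d d₀ α) (hα' : IsStdGradedHom d' d₀ α')
    (h : LinearMap.range α = LinearMap.range α')
    (hmin : ∀ v ∈ LinearMap.ker α, ∀ k, constantCoeff (v k) = 0)
    (hmin' : ∀ v ∈ LinearMap.ker α', ∀ k, constantCoeff (v k) = 0) :
    ∃ Θ : (Fin r → MvPolynomial (Fin n) K) ≃ₗ[MvPolynomial (Fin n) K]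
      (Fin r' → MvPolynomial (Fin n) K),
      IsStdGradedHom d d' Θ.toLinearMap ∧
      (LinearMap.ker α).map Θ.toLinearMap = LinearMap.ker α' ∧
      ∀ j, (Finset.univ.filter fun k => d k = j).card =
        (Finset.univ.filter fun k => d' k = j).card := by
  obtain ⟨Θ, hΘ, hαΘ⟩ := exists_graded_lift hα hα' h.le
  obtain ⟨Θ', hΘ', hαΘ'⟩ := exists_graded_lift hα' hα h.ge
  have e1 : ∀ v, α' (Θ v) = α v := LinearMap.congr_fun hαΘ
  have e2 : ∀ v, α (Θ' v) = α' v := LinearMap.congr_fun hαΘ'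
  -- `Θ' ∘ Θ` lifts `α` along itself, so it differs from the identity by vectors of `ker α`, which
  -- have no constant terms.
  have h1 : ∀ v i, constantCoeff ((Θ' (Θ v) - v) i) = 0 := fun v => hmin _ (by
    rw [LinearMap.mem_ker, map_sub, e2, e1, sub_self])
  have h2 : ∀ v i, constantCoeff ((Θ (Θ' v) - v) i) = 0 := fun v => hmin' _ (by
    rw [LinearMap.mem_ker, map_sub, e1, e2, sub_self])
  have b1 := IsStdGradedHom.bijective_of_congr_id (hΘ'.comp hΘ) h1
  have b2 := IsStdGradedHom.bijective_of_congr_id (hΘ.comp hΘ') h2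
  have hb : Function.Bijective Θ :=
    ⟨fun x y hxy => b1.1 (congrArg Θ' hxy), fun y => (b2.2 y).imp' Θ' fun _ hx => hx⟩
  refine ⟨LinearEquiv.ofBijective Θ hb, hΘ, ?_, fun j =>
    (card_le_card_of_comp_congr_id hΘ h1 j).antisymm (card_le_card_of_comp_congr_id hΘ' h2 j)⟩
  ext v
  constructor
  · rintro ⟨u, hu, rfl⟩
    exact (e1 u).trans hu
  · intro hv
    obtain ⟨u, rfl⟩ := hb.2 v
    exact ⟨u, (e1 u).symm.trans hv, rfl⟩

/-- Graded Betti numbers do not depend on the minimal graded free resolution. -/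
theorem MinimalGradedFreeResolution.betti_eq
    {N : Submodule (MvPolynomial (Fin n) K) (Fin r → MvPolynomial (Fin n) K)}
    (R R' : MinimalGradedFreeResolution d N) (i j : ℕ) : R.betti i j = R'.betti i j := by
  have key : ∀ i, ∃ Θ : (Fin (R.rank i) → MvPolynomial (Fin n) K) ≃ₗ[MvPolynomial (Fin n) K]
      (Fin (R'.rank i) → MvPolynomial (Fin n) K),
      IsStdGradedHom (R.deg i) (R'.deg i) Θ.toLinearMap ∧
      (LinearMap.range (R.diff i)).map Θ.toLinearMap = LinearMap.range (R'.diff i) ∧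
      ∀ j, R.betti i j = R'.betti i j := by
    intro i
    induction i with
    | zero =>
      obtain ⟨Θ, h1, h2, h3⟩ := exists_graded_equiv_of_minimal R.aug_graded R'.aug_graded
        (R.range_aug.trans R'.range_aug.symm)
        (fun v hv => mem_span_X_smul_top_iff.1 (R.minimal 0 (R.exact_zero ▸ hv)))
        (fun v hv => mem_span_X_smul_top_iff.1 (R'.minimal 0 (R'.exact_zero ▸ hv)))
      exact ⟨Θ, h1, by rw [← R.exact_zero, h2, R'.exact_zero], h3⟩
    | succ i ih =>
      obtain ⟨Θ, hΘ, hr, -⟩ := ih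
      -- Composing with `Θ` gives both differentials the same image in the same free module without
      -- changing the kernel.
      have hker : LinearMap.ker (Θ.toLinearMap ∘ₗ R.diff i) = LinearMap.ker (R.diff i) :=
        LinearEquiv.ker_comp _ _
      obtain ⟨Θ', h1, h2, h3⟩ := exists_graded_equiv_of_minimal
        (α := Θ.toLinearMap ∘ₗ R.diff i) (α' := R'.diff i)
        (IsGradedHom.comp hΘ (R.diff_graded i)) (R'.diff_graded i)
        (by rw [LinearMap.range_comp, hr])
        (fun v hv => mem_span_X_smul_top_iff.1
          (R.minimal (i + 1) (by rw [← R.exact_succ, ← hker]; exact hv)))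
        (fun v hv => mem_span_X_smul_top_iff.1
          (R'.minimal (i + 1) (by rw [← R'.exact_succ]; exact hv)))
      exact ⟨Θ', h1, by rw [← R.exact_succ, ← hker, h2, R'.exact_succ], h3⟩
  obtain ⟨-, -, -, h⟩ := key i
  exact h j

end Standard

/-! ### Minimal fine graded resolutions -/

section Fine

variable {K : Type*} [Field K] {n : ℕ}

variable (K n) in
/-- A fine graded submodule of a fine graded free module. -/
structure FineSubmodule where
  rank : ℕ
  deg : Fin rank → Fin n →₀ ℕ
  sub : Submodule (MvPolynomial (Fin n) K) (Fin rank → MvPolynomial (Fin n) K)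
  graded : IsGradedSubmodule (fineComponent (K := K) deg) sub

/-- The kernel of a minimal cover is again a bundled fine graded submodule, so the construction can
be iterated. -/
theorem FineSubmodule.exists_cover (M : FineSubmodule K n) :
    ∃ (S : FineSubmodule K n)
      (φ : (Fin S.rank → MvPolynomial (Fin n) K) →ₗ[MvPolynomial (Fin n) K]
        (Fin M.rank → MvPolynomial (Fin n) K)),
      IsFineGradedHom S.deg M.deg φ ∧ LinearMap.range φ = M.sub ∧ S.sub = LinearMap.ker φ ∧
        ∀ v ∈ S.sub, ∀ k, constantCoeff (v k) = 0 := by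
  obtain ⟨m, a, φ, h1, h2, h3⟩ := exists_minimal_generators
    (w := AddMonoidHom.id (Fin n →₀ ℕ)) (fun s hs => hs) M.graded
  exact ⟨⟨m, a, LinearMap.ker φ, h1.isGradedSubmodule_ker⟩, φ, h1, h2, rfl, h3⟩

/-- The iterated syzygy modules of a fine graded module, with respect to minimal systems of
homogeneous generators. -/
def FineSubmodule.syzygy (M : FineSubmodule K n) : ℕ → FineSubmodule K n
  | 0 => M
  | i + 1 => (M.syzygy i).exists_cover.choose

/-- The differentials of a minimal fine graded resolution, starting with the augmentation. -/
def FineSubmodule.cover (M : FineSubmodule K n) (i : ℕ) :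
    (Fin (M.syzygy (i + 1)).rank → MvPolynomial (Fin n) K) →ₗ[MvPolynomial (Fin n) K]
      (Fin (M.syzygy i).rank → MvPolynomial (Fin n) K) :=
  (M.syzygy i).exists_cover.choose_spec.choose

theorem FineSubmodule.cover_spec (M : FineSubmodule K n) (i : ℕ) :
    IsFineGradedHom (M.syzygy (i + 1)).deg (M.syzygy i).deg (M.cover i) ∧
      LinearMap.range (M.cover i) = (M.syzygy i).sub ∧
      (M.syzygy (i + 1)).sub = LinearMap.ker (M.cover i) ∧
      ∀ v ∈ (M.syzygy (i + 1)).sub, ∀ k, constantCoeff (v k) = 0 :=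
  (M.syzygy i).exists_cover.choose_spec.choose_spec

end Fine

/-! ### Distraction of maps, kernels, images and homology -/

section DistractHom

variable {K : Type*} [Field K] {n : ℕ} {L : Fin n → ℕ → MvPolynomial (Fin n) K}
  {r r' r'' : ℕ} {t : Fin r → Fin n →₀ ℕ} {t' : Fin r' → Fin n →₀ ℕ}
  {t'' : Fin r'' → Fin n →₀ ℕ}

theorem distract_apply (L : Fin n → ℕ → MvPolynomial (Fin n) K) (t : Fin r → Fin n →₀ ℕ)
    (v : Fin r → MvPolynomial (Fin n) K) (i : Fin r) :
    distract L t v i = distractTwist L (t i) (v i) :=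
  rfl

theorem IsDistractionMatrix.bijective_distract (hL : IsDistractionMatrix L)
    (t : Fin r → Fin n →₀ ℕ) : Function.Bijective (distract L t) := by
  constructor
  · intro v u h
    funext i
    exact (hL.bijective_distractTwist (t i)).1 (congrFun h i)
  · intro v
    choose u hu using fun i => (hL.bijective_distractTwist (t i)).2 (v i)
    exact ⟨u, funext hu⟩

theorem IsDistractionMatrix.distract_mem_stdComponent (hL : IsDistractionMatrix L)
    (t : Fin r → Fin n →₀ ℕ) (e : ℕ) (v : Fin r → MvPolynomial (Fin n) K)
    (hv : v ∈ stdComponent (stdDegrees t) e) :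
    distract L t v ∈ stdComponent (stdDegrees t) e := by
  intro i s hs
  rw [distract_apply] at hs
  by_cases h0 : v i = 0
  · rw [h0, map_zero, coeff_zero] at hs
    exact absurd rfl hs
  · obtain ⟨u, hu⟩ := ne_zero_iff.1 h0
    have hom : (v i).IsHomogeneous u.degree := by
      intro x hx
      rw [← hv i u hu] at hv
      have h1 : x.degree = u.degree := Nat.add_right_cancel (hv i x hx)
      rw [← h1, Finsupp.degree_eq_weight_one]
      rfl
    have h2 : s.degree = u.degree := by
      by_contra hne
      exact hs ((hL.isHomogeneous_distractTwist (t i) hom).coeff_eq_zero hne)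
    rw [h2]
    exact hv i u hu

theorem IsDistractionMatrix.map_distract_stdComponent (hL : IsDistractionMatrix L)
    (t : Fin r → Fin n →₀ ℕ) (e : ℕ) :
    (stdComponent (stdDegrees t) e).map (distract L t) = stdComponent (stdDegrees t) e := by
  refine le_antisymm ?_ fun v hv => ?_
  · rintro _ ⟨v, hv, rfl⟩
    exact hL.distract_mem_stdComponent t e v hv
  · obtain ⟨u, rfl⟩ := (hL.bijective_distract t).2 v
    -- The component of the preimage in degree `e` suffices, since the operator commutes with the
    -- projections.
    refine ⟨gradedProj Finsupp.degree (stdDegrees t) e u, gradedProj_mem _ _, ?_⟩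
    rw [map_gradedProj (hL.distract_mem_stdComponent t)]
    exact gradedProj_of_mem hv

variable {φ : (Fin r → MvPolynomial (Fin n) K) →ₗ[MvPolynomial (Fin n) K]
      (Fin r' → MvPolynomial (Fin n) K)}
  {ψ : (Fin r'' → MvPolynomial (Fin n) K) →ₗ[MvPolynomial (Fin n) K]
      (Fin r → MvPolynomial (Fin n) K)}

theorem IsFineGradedHom.isStdGradedHom (h : IsFineGradedHom t t' φ) :
    IsStdGradedHom (stdDegrees t) (stdDegrees t') φ := by
  refine isGradedHom_of_single fun k i s hs => ?_
  have := h _ _ (single_mem_gradedComponent (AddMonoidHom.id _) t k) i s hs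
  simp only [stdDegrees]
  rw [← map_add, this]

/-- For an entry `c s` with `s = tₖ / tᵢ'`, the product rule moves the twist from `tᵢ'` to `tₖ` and
produces the factor `D(tₖ) / D(tᵢ')`, which is the entry of `D(φ)` up to `c`. -/
theorem IsDistractionMatrix.distract_hom_apply (hL : IsDistractionMatrix L)
    (h : IsFineGradedHom t t' φ) (v : Fin r → MvPolynomial (Fin n) K) :
    distract L t' (φ v) = distractHom L t t' φ (distract L t v) := by
  classical
  funext i
  have h1 : φ v i = ∑ k, LinearMap.toMatrix' φ i k * v k := by
    conv_lhs => rw [← Matrix.toLin'_toMatrix' φ]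
    rfl
  have h2 : distractHom L t t' φ (distract L t v) i = ∑ k, C (homCoeff t t' φ i k) *
      colon (distractPP L (t k)) (distractPP L (t' i)) * distractTwist L (t k) (v k) :=
    rfl
  rw [distract_apply, h1, h2, map_sum]
  refine Finset.sum_congr rfl fun k _ => ?_
  rw [h.toMatrix'_apply]
  split_ifs with hle
  · have h3 := (add_tsub_cancel_of_le hle).symm
    set s := t k - t' i with hs
    have h4 : monomial s (homCoeff t t' φ i k) * v k =
        homCoeff t t' φ i k • (monomial s 1 * v k) := by
      rw [← smul_mul_assoc, smul_monomial, smul_eq_mul, mul_one]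
    rw [h4, map_smul, hL.distractTwist_monomial_mul, smul_eq_C_mul, h3, hL.colon_distractPP_add,
      mul_assoc]
  -- If `tᵢ'` does not divide `tₖ`, the scalar vanishes, so the value of the colon is irrelevant.
  · have h3 : homCoeff t t' φ i k = 0 := by
      rw [homCoeff, h.toMatrix'_apply, if_neg hle, coeff_zero]
    rw [h3, zero_mul, map_zero, map_zero, zero_mul, zero_mul]

theorem IsDistractionMatrix.isStdGradedHom_distractHom (hL : IsDistractionMatrix L)
    (h : IsFineGradedHom t t' φ) :
    IsStdGradedHom (stdDegrees t) (stdDegrees t') (distractHom L t t' φ) := by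
  intro e v hv
  rw [← hL.map_distract_stdComponent] at hv
  obtain ⟨u, hu, rfl⟩ := hv
  rw [← hL.distract_hom_apply h]
  exact hL.distract_mem_stdComponent t' e _ (h.isStdGradedHom e u hu)

/-- The nontrivial inclusion needs the operator to be surjective on the source and injective on the
target. -/
theorem IsDistractionMatrix.map_distract_ker (hL : IsDistractionMatrix L)
    (h : IsFineGradedHom t t' φ) :
    ((LinearMap.ker φ).restrictScalars K).map (distract L t) =
      (LinearMap.ker (distractHom L t t' φ)).restrictScalars K := by
  refine le_antisymm ?_ fun v hv => ?_
  · rintro _ ⟨u, hu, rfl⟩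
    have hu' : φ u = 0 := hu
    exact LinearMap.mem_ker.2 (by rw [← hL.distract_hom_apply h, hu', map_zero])
  · obtain ⟨u, rfl⟩ := (hL.bijective_distract t).2 v
    refine ⟨u, (hL.bijective_distract t').1 ?_, rfl⟩
    rw [hL.distract_hom_apply h, map_zero]
    exact hv

theorem IsDistractionMatrix.map_distract_range (hL : IsDistractionMatrix L)
    (h : IsFineGradedHom t t' φ) :
    ((LinearMap.range φ).restrictScalars K).map (distract L t') =
      (LinearMap.range (distractHom L t t' φ)).restrictScalars K := by
  refine le_antisymm ?_ ?_
  · rintro _ ⟨_, ⟨u, rfl⟩, rfl⟩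
    exact ⟨distract L t u, (hL.distract_hom_apply h u).symm⟩
  · rintro _ ⟨v, rfl⟩
    obtain ⟨u, rfl⟩ := (hL.bijective_distract t).2 v
    exact ⟨φ u, ⟨u, rfl⟩, hL.distract_hom_apply h u⟩

theorem IsDistractionMatrix.distractHom_comp_eq_zero (hL : IsDistractionMatrix L)
    (hψ : IsFineGradedHom t'' t ψ) (hφ : IsFineGradedHom t t' φ) (h : φ ∘ₗ ψ = 0) :
    distractHom L t t' φ ∘ₗ distractHom L t'' t ψ = 0 := by
  refine LinearMap.ext fun v => ?_
  obtain ⟨u, rfl⟩ := (hL.bijective_distract t'').2 v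
  have h0 : φ (ψ u) = 0 := LinearMap.congr_fun h u
  rw [LinearMap.comp_apply, ← hL.distract_hom_apply hψ, ← hL.distract_hom_apply hφ, h0, map_zero,
    LinearMap.zero_apply]

/-- The bijection between the kernels of a fine graded map and of its distraction. -/
def distractKer (hL : IsDistractionMatrix L) (h : IsFineGradedHom t t' φ) :
    LinearMap.ker φ ≃ₗ[K] LinearMap.ker (distractHom L t t' φ) :=
  ((LinearEquiv.ofBijective (distract L t) (hL.bijective_distract t)).submoduleMap
      ((LinearMap.ker φ).restrictScalars K)).trans
    (LinearEquiv.ofEq _ ((LinearMap.ker (distractHom L t t' φ)).restrictScalars K)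
      (hL.map_distract_ker h))

theorem coe_distractKer (hL : IsDistractionMatrix L) (h : IsFineGradedHom t t' φ)
    (v : LinearMap.ker φ) :
    (distractKer hL h v : Fin r → MvPolynomial (Fin n) K) = distract L t v :=
  rfl

/-- The isomorphism on homology induced by the distraction operator. -/
def distractHomology (hL : IsDistractionMatrix L) (hψ : IsFineGradedHom t'' t ψ)
    (hφ : IsFineGradedHom t t' φ) :
    Homology ψ φ ≃ₗ[K] Homology (distractHom L t'' t ψ) (distractHom L t t' φ) :=
  (Submodule.Quotient.restrictScalarsEquiv K
      ((LinearMap.range ψ).submoduleOf (LinearMap.ker φ))).symm ≪≫ₗ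
    Submodule.Quotient.equiv _
      (((LinearMap.range (distractHom L t'' t ψ)).submoduleOf
        (LinearMap.ker (distractHom L t t' φ))).restrictScalars K) (distractKer hL hφ) (by
      have hr := fun v => SetLike.ext_iff.1 (hL.map_distract_range hψ) v
      ext v
      constructor
      · rintro ⟨u, hu, rfl⟩
        exact (hr _).1 ⟨u, hu, rfl⟩
      · intro hv
        obtain ⟨u, rfl⟩ := (distractKer hL hφ).surjective v
        obtain ⟨y, hy, hyu⟩ := (hr _).2 hv
        refine ⟨u, ?_, rfl⟩
        have : y = u := (hL.bijective_distract t).1 hyu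
        change (u : Fin r → MvPolynomial (Fin n) K) ∈ LinearMap.range ψ
        exact this ▸ hy) ≪≫ₗ
    Submodule.Quotient.restrictScalarsEquiv K
      ((LinearMap.range (distractHom L t'' t ψ)).submoduleOf
        (LinearMap.ker (distractHom L t t' φ)))

theorem distractHomology_mk (hL : IsDistractionMatrix L) (hψ : IsFineGradedHom t'' t ψ)
    (hφ : IsFineGradedHom t t' φ) (v : LinearMap.ker φ) :
    distractHomology hL hψ hφ (Submodule.Quotient.mk v) =
      Submodule.Quotient.mk (distractKer hL hφ v) :=
  rfl

theorem mem_homologyComponent {d : Fin r → ℕ} {e : ℕ} {x : Homology ψ φ} :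
    x ∈ homologyComponent d ψ φ e ↔ ∃ v : LinearMap.ker φ,
      (v : Fin r → MvPolynomial (Fin n) K) ∈ stdComponent (K := K) d e ∧
        Submodule.Quotient.mk v = x :=
  Iff.rfl

theorem map_distractHomology (hL : IsDistractionMatrix L) (hψ : IsFineGradedHom t'' t ψ)
    (hφ : IsFineGradedHom t t' φ) (e : ℕ) :
    (homologyComponent (stdDegrees t) ψ φ e).map (distractHomology hL hψ hφ).toLinearMap =
      homologyComponent (stdDegrees t) (distractHom L t'' t ψ) (distractHom L t t' φ) e := by
  refine le_antisymm ?_ ?_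
  · rintro _ ⟨_, ⟨v, hv, rfl⟩, rfl⟩
    exact mem_homologyComponent.2 ⟨distractKer hL hφ v, hL.distract_mem_stdComponent t e _ hv, rfl⟩
  · intro x hx
    obtain ⟨v, hv, rfl⟩ := mem_homologyComponent.1 hx
    obtain ⟨u, rfl⟩ := (distractKer hL hφ).surjective v
    rw [coe_distractKer, ← hL.map_distract_stdComponent] at hv
    obtain ⟨y, hy, hyu⟩ := hv
    have : y = u := (hL.bijective_distract t).1 hyu
    exact ⟨_, mem_homologyComponent.2 ⟨u, this ▸ hy, rfl⟩, rfl⟩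

end DistractHom

/-! ### Resolutions of the distracted module -/

section Resolution

variable {K : Type*} [Field K] {n : ℕ} {L : Fin n → ℕ → MvPolynomial (Fin n) K}

/-- A minimal resolution of a fine graded module. -/
def FineSubmodule.resolution (M : FineSubmodule K n) :
    MinimalGradedFreeResolution (stdDegrees M.deg) M.sub where
  rank i := (M.syzygy (i + 1)).rank
  deg i := stdDegrees (M.syzygy (i + 1)).deg
  aug := M.cover 0
  diff i := M.cover (i + 1)
  aug_graded := (M.cover_spec 0).1.isStdGradedHom
  diff_graded i := (M.cover_spec (i + 1)).1.isStdGradedHom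
  range_aug := (M.cover_spec 0).2.1
  exact_zero := (M.cover_spec 0).2.2.1.symm.trans (M.cover_spec 1).2.1.symm
  exact_succ i := (M.cover_spec (i + 1)).2.2.1.symm.trans (M.cover_spec (i + 2)).2.1.symm
  minimal i := fun v hv => mem_span_X_smul_top_iff.2
    ((M.cover_spec i).2.2.2 v ((M.cover_spec (i + 1)).2.1 ▸ hv))

/-- The submodule whose underlying vector space is the image of a fine graded module under the
distraction operator. -/
def FineSubmodule.distraction (L : Fin n → ℕ → MvPolynomial (Fin n) K) (M : FineSubmodule K n) :
    Submodule (MvPolynomial (Fin n) K) (Fin M.rank → MvPolynomial (Fin n) K) :=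
  LinearMap.range (distractHom L (M.syzygy 1).deg M.deg (M.cover 0))

/-- The operator is not P-linear, so closure of `D(M)` under P is not evident. It follows because
`D(M)` is the image of a P-linear map, the distracted cover. -/
theorem FineSubmodule.restrictScalars_distraction (hL : IsDistractionMatrix L)
    (M : FineSubmodule K n) :
    (M.distraction L).restrictScalars K = (M.sub.restrictScalars K).map (distract L M.deg) :=
  (hL.map_distract_range (M.cover_spec 0).1).symm.trans
    (congrArg (fun N => (N.restrictScalars K).map (distract L M.deg)) (M.cover_spec 0).2.1)

theorem FineSubmodule.distractHom_exact (hL : IsDistractionMatrix L) (M : FineSubmodule K n)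
    (i : ℕ) :
    LinearMap.ker (distractHom L (M.syzygy (i + 1)).deg (M.syzygy i).deg (M.cover i)) =
      LinearMap.range (distractHom L (M.syzygy (i + 2)).deg (M.syzygy (i + 1)).deg
        (M.cover (i + 1))) := by
  refine Submodule.restrictScalars_injective K _ _ ?_
  rw [← hL.map_distract_ker (M.cover_spec i).1, ← hL.map_distract_range (M.cover_spec (i + 1)).1,
    ← (M.cover_spec i).2.2.1, (M.cover_spec (i + 1)).2.1]

/-- The distraction of a minimal resolution of a fine graded module. -/
def FineSubmodule.distractResolution (hL : IsDistractionMatrix L) (M : FineSubmodule K n) :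
    MinimalGradedFreeResolution (stdDegrees M.deg) (M.distraction L) where
  rank i := (M.syzygy (i + 1)).rank
  deg i := stdDegrees (M.syzygy (i + 1)).deg
  aug := distractHom L (M.syzygy 1).deg M.deg (M.cover 0)
  diff i := distractHom L (M.syzygy (i + 2)).deg (M.syzygy (i + 1)).deg (M.cover (i + 1))
  aug_graded := hL.isStdGradedHom_distractHom (M.cover_spec 0).1
  diff_graded i := hL.isStdGradedHom_distractHom (M.cover_spec (i + 1)).1
  range_aug := rfl
  exact_zero := M.distractHom_exact hL 0
  exact_succ i := M.distractHom_exact hL (i + 1)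
  minimal i := by
    rintro _ ⟨v, rfl⟩
    -- The vector is thus the distraction of a vector in the image of the original differential, and
    -- constant terms are unchanged.
    obtain ⟨u, rfl⟩ := (hL.bijective_distract (M.syzygy (i + 2)).deg).2 v
    rw [← hL.distract_hom_apply (M.cover_spec (i + 1)).1]
    refine mem_span_X_smul_top_iff.2 fun k => ?_
    rw [distract_apply, hL.constantCoeff_distractTwist]
    exact (M.cover_spec i).2.2.2 _ ((M.cover_spec (i + 1)).2.1 ▸ ⟨u, rfl⟩) k

end Resolution

end Distraction

end

theorem mainTheorem7 {K : Type*} [Field K] [Infinite K] {n : ℕ}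
    (L : Fin n → ℕ → MvPolynomial (Fin n) K) (hL : Distraction.IsDistractionMatrix L) :
    -- the distraction operators on fine graded free modules are bijective and preserve
    -- the standard degree
    (∀ (r : ℕ) (t : Fin r → Fin n →₀ ℕ),
      Function.Bijective (Distraction.distract L t) ∧
      ∀ e : ℕ, (Distraction.stdComponent (Distraction.stdDegrees t) e).map
          (Distraction.distract L t) =
        Distraction.stdComponent (Distraction.stdDegrees t) e) ∧
    -- complexes of fine graded free modules
    (∀ (r'' r r' : ℕ) (t'' : Fin r'' → Fin n →₀ ℕ) (t : Fin r → Fin n →₀ ℕ)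
      (t' : Fin r' → Fin n →₀ ℕ)
      (ψ : (Fin r'' → MvPolynomial (Fin n) K) →ₗ[MvPolynomial (Fin n) K]
        (Fin r → MvPolynomial (Fin n) K))
      (φ : (Fin r → MvPolynomial (Fin n) K) →ₗ[MvPolynomial (Fin n) K]
        (Fin r' → MvPolynomial (Fin n) K)),
      Distraction.IsFineGradedHom t'' t ψ → Distraction.IsFineGradedHom t t' φ →
      φ ∘ₗ ψ = 0 →
      -- the distracted maps are standard graded and form a complex
      Distraction.IsStdGradedHom (Distraction.stdDegrees t'') (Distraction.stdDegrees t)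
        (Distraction.distractHom L t'' t ψ) ∧
      Distraction.IsStdGradedHom (Distraction.stdDegrees t) (Distraction.stdDegrees t')
        (Distraction.distractHom L t t' φ) ∧
      Distraction.distractHom L t t' φ ∘ₗ Distraction.distractHom L t'' t ψ = 0 ∧
      -- commutative diagram
      (∀ v, Distraction.distract L t (ψ v) =
        Distraction.distractHom L t'' t ψ (Distraction.distract L t'' v)) ∧
      (∀ v, Distraction.distract L t' (φ v) =
        Distraction.distractHom L t t' φ (Distraction.distract L t v)) ∧
      -- kernels and images
      ((LinearMap.ker φ).restrictScalars K).map (Distraction.distract L t) =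
        (LinearMap.ker (Distraction.distractHom L t t' φ)).restrictScalars K ∧
      ((LinearMap.range φ).restrictScalars K).map (Distraction.distract L t') =
        (LinearMap.range (Distraction.distractHom L t t' φ)).restrictScalars K ∧
      -- the induced map on homology is a degree preserving isomorphism
      ∃ E : Distraction.Homology ψ φ ≃ₗ[K]
          Distraction.Homology (Distraction.distractHom L t'' t ψ)
            (Distraction.distractHom L t t' φ),
        (∀ (v : LinearMap.ker φ) (w : LinearMap.ker (Distraction.distractHom L t t' φ)),
          (w : Fin r → MvPolynomial (Fin n) K) = Distraction.distract L t v →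
          E (Submodule.Quotient.mk v) = Submodule.Quotient.mk w) ∧
        ∀ e : ℕ, (Distraction.homologyComponent (Distraction.stdDegrees t) ψ φ e).map
            E.toLinearMap =
          Distraction.homologyComponent (Distraction.stdDegrees t)
            (Distraction.distractHom L t'' t ψ) (Distraction.distractHom L t t' φ) e) ∧
    -- Betti numbers
    (∀ (r : ℕ) (t : Fin r → Fin n →₀ ℕ)
      (M : Submodule (MvPolynomial (Fin n) K) (Fin r → MvPolynomial (Fin n) K)),
      Distraction.IsGradedSubmodule (Distraction.fineComponent (K := K) t) M →
      ∃ N : Submodule (MvPolynomial (Fin n) K) (Fin r → MvPolynomial (Fin n) K),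
        N.restrictScalars K = (M.restrictScalars K).map (Distraction.distract L t) ∧
        Distraction.IsGradedSubmodule
          (Distraction.stdComponent (K := K) (Distraction.stdDegrees t)) N ∧
        Nonempty (Distraction.MinimalGradedFreeResolution (Distraction.stdDegrees t) M) ∧
        Nonempty (Distraction.MinimalGradedFreeResolution (Distraction.stdDegrees t) N) ∧
        ∀ (R : Distraction.MinimalGradedFreeResolution (Distraction.stdDegrees t) M)
          (R' : Distraction.MinimalGradedFreeResolution (Distraction.stdDegrees t) N)
          (i j : ℕ), R.betti i j = R'.betti i j) := by
  refine ⟨fun r t => ⟨hL.bijective_distract t, hL.map_distract_stdComponent t⟩, ?_, ?_⟩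
  · intro r'' r r' t'' t t' ψ φ hψ hφ h
    refine ⟨hL.isStdGradedHom_distractHom hψ, hL.isStdGradedHom_distractHom hφ,
      hL.distractHom_comp_eq_zero hψ hφ h, hL.distract_hom_apply hψ, hL.distract_hom_apply hφ,
      hL.map_distract_ker hφ, hL.map_distract_range hφ,
      Distraction.distractHomology hL hψ hφ, ?_, Distraction.map_distractHomology hL hψ hφ⟩
    intro v w hw
    rw [Distraction.distractHomology_mk]
    exact congrArg _ (Subtype.ext hw.symm)
  · intro r t M hM
    let S : Distraction.FineSubmodule K n := ⟨r, t, M, hM⟩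
    refine ⟨S.distraction L, S.restrictScalars_distraction hL,
      Distraction.IsGradedHom.isGradedSubmodule_range
        (hL.isStdGradedHom_distractHom (S.cover_spec 0).1),
      ⟨S.resolution⟩, ⟨S.distractResolution hL⟩, fun R R' i j => ?_⟩
    -- Both reference resolutions have the same ranks and degrees by construction.
    rw [R.betti_eq S.resolution, R'.betti_eq (S.distractResolution hL)]
    rfl
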